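/- Let $d\ge 2$ be an integer, let $0<\theta<\tfrac12$, and put $$F(s)=\frac{s^2}{2}\Bigl(1-\frac{|s|^{-2\theta}}{1-\theta}\Bigr),\qquad p=(1-\theta)^{-1/(2\theta)}.$$ Then $p>1$ and $p$ is the only zero of $F$ in $(0,\infty)$. For every $a\in(1,p)$ the radial problem $$u''+\frac{d-1}{r}\,u'+u-|u|^{-2\theta}u=0\quad\text{on }(0,\infty),\qquad u(0)=a,\quad u'(0)=0$$ (where $|u|^{-2\theta}u$ is read as $0$ at points where $u=0$, and $u'(0)$ is the one-sided derivative) has exactly one real-valued solution $u\in C^1([0,\infty))\cap C^2((0,\infty))$. This solution belongs to $C^2([0,\infty))$, is positive on $[0,\infty)$, and oscillates around $1$ in the following sense: there are sequences $(r_k)_{k\ge0}$ and $(t_k)_{k\ge0}$ with $0<r_0<t_0<r_1<t_1<\cdots$ and $r_k\to\infty$ such that $\{r_k : k\ge 0\}$ is the set of all points of $(0,\infty)$ where $u=1$, $\{t_k : k\ge 0\}$ is the set of all critical points of $u$ in $(0,\infty)$, and $u(t_k)-1$ and $u(t_{k+1})-1$ have opposite signs for every $k$. -/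

import Mathlib

open Set Filter Topology

noncomputable section

/-- The potential `F(s) = (s² / 2) (1 - |s|^{-2θ} / (1 - θ))`, the primitive vanishing at `0` of
`f(s) = s - |s|^{-2θ} s`. -/
def potentialF (θ s : ℝ) : ℝ :=
  s ^ 2 / 2 * (1 - |s| ^ (-(2 * θ)) / (1 - θ))

/-- The number `p = (1 - θ)^{-1/(2θ)}`, the positive zero of `F`. -/
def thresholdP (θ : ℝ) : ℝ :=
  (1 - θ) ^ (-(1 / (2 * θ)))

/-- Classical solutions on `[0, ∞)` of the radial problem
`u'' + (d - 1) / r * u' + u - |u|^{-2θ} u = 0` on `(0, ∞)`, `u(0) = a`, `u'(0) = 0`: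
`u` is `C¹` on `[0, ∞)` and `C²` on `(0, ∞)`. No sign condition is imposed on `u`. Only the values
of `u` on `[0, ∞)` matter; the derivative at `0` is one-sided. Where `u r = 0` the term
`|u r|^{-2θ} u r` is `0`, its value by continuity, because `2θ < 1`. -/
structure IsRadialSolution (d : ℕ) (θ a : ℝ) (u : ℝ → ℝ) : Prop where
  contDiffOn_one : ContDiffOn ℝ 1 u (Ici 0)
  contDiffOn_two : ContDiffOn ℝ 2 u (Ioi 0)
  equation : ∀ r : ℝ, 0 < r →
    deriv (deriv u) r + ((d : ℝ) - 1) / r * deriv u r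
      + u r - |u r| ^ (-(2 * θ)) * u r = 0
  value_zero : u 0 = a
  deriv_zero : HasDerivWithinAt u 0 (Ici 0) 0

/-- `u` oscillates around `c` on `(0, ∞)`: the points of `(0, ∞)` where `u = c` and the critical
points of `u` in `(0, ∞)` form two interlaced sequences
`0 < r₀ < t₀ < r₁ < t₁ < ⋯` tending to infinity, and the critical values `u(t₀), u(t₁), …`
lie alternately on the two sides of `c`. -/
def OscillatesAround (u : ℝ → ℝ) (c : ℝ) : Prop :=
  ∃ r t : ℕ → ℝ,
    0 < r 0 ∧ (∀ k, r k < t k ∧ t k < r (k + 1)) ∧ Tendsto r atTop atTop ∧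
    (∀ x, 0 < x → (u x = c ↔ ∃ k, x = r k)) ∧
    (∀ x, 0 < x → (deriv u x = 0 ↔ ∃ k, x = t k)) ∧
    (∀ k, (u (t k) - c) * (u (t (k + 1)) - c) < 0)

end

noncomputable section

/-- The nonlinearity `f(s) = s - |s|^{-2θ} s`. -/
def nonlinearity (θ s : ℝ) : ℝ := s - |s| ^ (-(2 * θ)) * s

lemma potentialF_eq {θ : ℝ} (h₁ : θ < 1 / 2) (s : ℝ) :
    potentialF θ s = s ^ 2 / 2 - |s| ^ (2 - 2 * θ) / (2 * (1 - θ)) := by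
  have h : |s| ^ (2 - 2 * θ) = s ^ 2 * |s| ^ (-(2 * θ)) := by
    rcases eq_or_ne s 0 with rfl | hs
    · simp only [abs_zero]
      rw [Real.zero_rpow (by linarith)]
      simp
    · rw [sub_eq_add_neg, Real.rpow_add (abs_pos.2 hs)]
      simp
  have h2 : (1 - θ) ≠ 0 := by linarith
  rw [potentialF, h]
  field_simp

lemma hasDerivAt_potentialF {θ : ℝ} (h₁ : θ < 1 / 2) (s : ℝ) :
    HasDerivAt (potentialF θ) (nonlinearity θ s) s := by
  have h2 : (1 - θ) ≠ 0 := by linarith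
  have h := ((hasDerivAt_pow 2 s).div_const 2).sub
    ((hasDerivAt_abs_rpow s (p := 2 - 2 * θ) (by linarith)).div_const (2 * (1 - θ)))
  rw [funext (potentialF_eq h₁)]
  refine h.congr_deriv ?_
  rw [nonlinearity, show 2 - 2 * θ - 2 = -(2 * θ) by ring]
  field_simp
  push_cast
  ring

lemma continuous_potentialF {θ : ℝ} (h₁ : θ < 1 / 2) : Continuous (potentialF θ) :=
  continuous_iff_continuousAt.2 fun s => (hasDerivAt_potentialF h₁ s).continuousAt

lemma nonlinearity_of_pos {θ s : ℝ} (hs : 0 < s) :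
    nonlinearity θ s = s * (1 - s ^ (-(2 * θ))) := by
  rw [nonlinearity, abs_of_pos hs]; ring

lemma nonlinearity_pos {θ s : ℝ} (h₀ : 0 < θ) (hs : 1 < s) : 0 < nonlinearity θ s := by
  rw [nonlinearity_of_pos (by linarith)]
  have := Real.rpow_lt_one_of_one_lt_of_neg hs (z := -(2 * θ)) (by linarith)
  exact mul_pos (by linarith) (by linarith)

lemma nonlinearity_neg {θ s : ℝ} (h₀ : 0 < θ) (hs₀ : 0 < s) (hs : s < 1) :
    nonlinearity θ s < 0 := by
  rw [nonlinearity_of_pos hs₀]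
  have := Real.one_lt_rpow_of_pos_of_lt_one_of_neg hs₀ hs (z := -(2 * θ)) (by linarith)
  exact mul_neg_of_pos_of_neg hs₀ (by linarith)

lemma nonlinearity_ne_zero {θ s : ℝ} (h₀ : 0 < θ) (hs₀ : 0 < s) (hs : s ≠ 1) :
    nonlinearity θ s ≠ 0 := by
  rcases lt_or_gt_of_ne hs with h | h
  · exact (nonlinearity_neg h₀ hs₀ h).ne
  · exact (nonlinearity_pos h₀ h).ne'

lemma potentialF_strictMonoOn {θ : ℝ} (h₀ : 0 < θ) (h₁ : θ < 1 / 2) :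
    StrictMonoOn (potentialF θ) (Ici 1) := by
  refine strictMonoOn_of_deriv_pos (convex_Ici 1) (continuous_potentialF h₁).continuousOn ?_
  intro x hx
  rw [interior_Ici] at hx
  rw [(hasDerivAt_potentialF h₁ x).deriv]
  exact nonlinearity_pos h₀ hx

lemma potentialF_strictAntiOn {θ : ℝ} (h₀ : 0 < θ) (h₁ : θ < 1 / 2) :
    StrictAntiOn (potentialF θ) (Icc 0 1) := by
  refine strictAntiOn_of_deriv_neg (convex_Icc 0 1) (continuous_potentialF h₁).continuousOn ?_
  intro x hx
  rw [interior_Icc] at hx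
  rw [(hasDerivAt_potentialF h₁ x).deriv]
  exact nonlinearity_neg h₀ hx.1 hx.2

lemma potentialF_one_le {θ s : ℝ} (h₀ : 0 < θ) (h₁ : θ < 1 / 2) (hs : 0 < s) :
    potentialF θ 1 ≤ potentialF θ s := by
  rcases le_total s 1 with h | h
  · exact (potentialF_strictAntiOn h₀ h₁).antitoneOn ⟨hs.le, h⟩ ⟨zero_le_one, le_rfl⟩ h
  · exact (potentialF_strictMonoOn h₀ h₁).monotoneOn (mem_Ici.2 le_rfl) h h

lemma potentialF_zero (θ : ℝ) : potentialF θ 0 = 0 := by simp [potentialF]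

lemma one_lt_thresholdP {θ : ℝ} (h₀ : 0 < θ) (h₁ : θ < 1 / 2) : 1 < thresholdP θ :=
  Real.one_lt_rpow_of_pos_of_lt_one_of_neg (by linarith) (by linarith)
    (neg_lt_zero.2 (by positivity))

lemma potentialF_thresholdP {θ : ℝ} (h₀ : 0 < θ) (h₁ : θ < 1 / 2) :
    potentialF θ (thresholdP θ) = 0 := by
  have hp : 0 < thresholdP θ := by linarith [one_lt_thresholdP h₀ h₁]
  have h2 : (1 - θ) ≠ 0 := by linarith
  rw [potentialF, abs_of_pos hp, thresholdP, ← Real.rpow_mul (by linarith),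
    show -(1 / (2 * θ)) * -(2 * θ) = 1 by field_simp, Real.rpow_one, div_self h2]
  ring

lemma potentialF_eq_zero_iff {θ s : ℝ} (h₀ : 0 < θ) (h₁ : θ < 1 / 2) (hs : 0 < s) :
    potentialF θ s = 0 ↔ s = thresholdP θ := by
  refine ⟨fun h => ?_, fun h => h ▸ potentialF_thresholdP h₀ h₁⟩
  rcases le_or_gt s 1 with h1 | h1
  · have := potentialF_strictAntiOn h₀ h₁ ⟨le_rfl, zero_le_one⟩ ⟨hs.le, h1⟩ hs
    rw [potentialF_zero, h] at this
    exact absurd this (lt_irrefl _)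
  · exact (potentialF_strictMonoOn h₀ h₁).injOn h1.le (one_lt_thresholdP h₀ h₁).le
      (h.trans (potentialF_thresholdP h₀ h₁).symm)

lemma potentialF_neg {θ a : ℝ} (h₀ : 0 < θ) (h₁ : θ < 1 / 2) (ha : 1 < a)
    (hap : a < thresholdP θ) : potentialF θ a < 0 := by
  rw [← potentialF_thresholdP h₀ h₁]
  exact potentialF_strictMonoOn h₀ h₁ ha.le (ha.trans hap).le hap

lemma exists_potentialF_gt {θ a : ℝ} (h₀ : 0 < θ) (h₁ : θ < 1 / 2) (ha : 1 < a)
    (hap : a < thresholdP θ) : ∃ b, 0 < b ∧ b < 1 ∧ potentialF θ a < potentialF θ b := by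
  have h : ∀ᶠ s in 𝓝 (0 : ℝ), potentialF θ a < potentialF θ s :=
    (continuous_potentialF h₁).continuousAt.eventually
      (lt_mem_nhds (by rw [potentialF_zero]; exact potentialF_neg h₀ h₁ ha hap))
  have h' : ∀ᶠ s in 𝓝[>] (0 : ℝ), s ∈ Ioo (0 : ℝ) 1 := Ioo_mem_nhdsGT zero_lt_one
  obtain ⟨b, hb, hb'⟩ := ((h.filter_mono nhdsWithin_le_nhds).and h').exists
  exact ⟨b, hb'.1, hb'.2, hb⟩

lemma contDiffOn_nonlinearity (θ : ℝ) : ContDiffOn ℝ 1 (nonlinearity θ) (Ioi 0) := by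
  have h : ContDiffOn ℝ 1 (fun s : ℝ => s * (1 - s ^ (-(2 * θ)))) (Ioi 0) :=
    contDiffOn_id.mul (contDiffOn_const.sub
      (contDiffOn_id.rpow_const_of_ne fun x hx => (mem_Ioi.1 hx).ne'))
  exact h.congr fun s hs => nonlinearity_of_pos hs

/-- A bounded Lipschitz function agreeing with the nonlinearity on `[b, p]`. -/
lemma exists_truncation (θ : ℝ) {b p : ℝ} (hb : 0 < b) (hbp : b ≤ p) :
    ∃ (g : ℝ → ℝ) (K : NNReal) (C : ℝ), LipschitzWith K g ∧ (∀ s, |g s| ≤ C) ∧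
      EqOn g (nonlinearity θ) (Icc b p) := by
  have hc : ContDiffOn ℝ 1 (nonlinearity θ) (Icc b p) :=
    (contDiffOn_nonlinearity θ).mono fun x hx => hb.trans_le hx.1
  obtain ⟨K, hK⟩ := hc.exists_lipschitzOnWith one_ne_zero (convex_Icc b p) isCompact_Icc
  obtain ⟨C, hC⟩ := isCompact_Icc.exists_bound_of_continuousOn hc.continuousOn
  refine ⟨fun s => nonlinearity θ (projIcc b p hbp s), K, C, ?_, fun s => hC _ (projIcc b p hbp s).2,
    fun s hs => by simp [projIcc_of_mem hbp hs]⟩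
  have := (lipschitzOnWith_iff_restrict.1 hK).comp (LipschitzWith.projIcc hbp)
  rwa [mul_one] at this

/-- `u` and its derivative `v` solve `u'' + (n / r) u' + g(u) = 0` on `(0, ∞)` with `u(0) = a` and
`u'(0) = 0`. -/
structure RadialODE (n : ℕ) (g : ℝ → ℝ) (a : ℝ) (u v : ℝ → ℝ) : Prop where
  continuousOn_fst : ContinuousOn u (Ici 0)
  continuousOn_snd : ContinuousOn v (Ici 0)
  fst_zero : u 0 = a
  snd_zero : v 0 = 0
  hasDerivAt_fst : ∀ r, 0 < r → HasDerivAt u (v r) r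
  hasDerivAt_snd : ∀ r, 0 < r → HasDerivAt v (-(n / r * v r) - g (u r)) r

namespace RadialODE

variable {n : ℕ} {g g₁ Φ : ℝ → ℝ} {a b p : ℝ} {u v w z : ℝ → ℝ}

lemma congr (h : RadialODE n g a u v) (hg : ∀ r, 0 < r → g (u r) = g₁ (u r)) :
    RadialODE n g₁ a u v :=
  ⟨h.1, h.2, h.3, h.4, h.5, fun r hr => hg r hr ▸ h.6 r hr⟩

lemma energy_le (h : RadialODE n g a u v) (hΦ : ∀ s, HasDerivAt Φ (g s) s) {r : ℝ} (hr : 0 ≤ r) :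
    Φ (u r) ≤ Φ a := by
  have hΦc : Continuous Φ := continuous_iff_continuousAt.2 fun s => (hΦ s).continuousAt
  have hd : ∀ r, 0 < r → HasDerivAt (fun r => v r ^ 2 / 2 + Φ (u r)) (-(n / r * v r ^ 2)) r := by
    intro r hr
    have := (((h.hasDerivAt_snd r hr).pow 2).div_const 2).add
      ((hΦ (u r)).comp r (h.hasDerivAt_fst r hr))
    refine this.congr_deriv ?_
    push_cast
    ring
  have hanti : AntitoneOn (fun r => v r ^ 2 / 2 + Φ (u r)) (Ici 0) := by
    refine antitoneOn_of_deriv_nonpos (convex_Ici 0)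
      (((h.continuousOn_snd.pow 2).div_const 2).add (hΦc.comp_continuousOn h.continuousOn_fst))
      ?_ ?_
    · rw [interior_Ici]
      exact fun r hr => (hd r hr).differentiableAt.differentiableWithinAt
    · rw [interior_Ici]
      intro r hr
      rw [(hd r hr).deriv]
      have : 0 < r := hr
      exact neg_nonpos.2 (by positivity)
  have := hanti (mem_Ici.2 le_rfl) hr hr
  simp only [h.fst_zero, h.snd_zero] at this
  nlinarith [sq_nonneg (v r)]

lemma mem_Ioo (h : RadialODE n g a u v) (hΦ : ∀ s, HasDerivAt Φ (g s) s) (hb : b < a) (hp : a < p)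
    (hΦb : Φ a < Φ b) (hΦp : Φ a < Φ p) {r : ℝ} (hr : 0 ≤ r) : u r ∈ Ioo b p := by
  have hc : ContinuousOn u (Icc 0 r) := h.continuousOn_fst.mono Icc_subset_Ici_self
  constructor
  · by_contra! hle
    obtain ⟨x, hx, hxb⟩ := intermediate_value_Icc' hr hc ⟨hle, h.fst_zero.symm ▸ hb.le⟩
    exact absurd (h.energy_le hΦ hx.1) (by rw [hxb]; exact not_le.2 hΦb)
  · by_contra! hle
    obtain ⟨x, hx, hxb⟩ := intermediate_value_Icc hr hc ⟨h.fst_zero.symm ▸ hp.le, hle⟩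
    exact absurd (h.energy_le hΦ hx.1) (by rw [hxb]; exact not_le.2 hΦp)

lemma eqOn {K : NNReal} (h : RadialODE n g a u v) (h' : RadialODE n g a w z)
    (hg : LipschitzWith K g) : EqOn u w (Ici 0) := by
  set H : ℝ → ℝ := fun r => ((v r - z r) ^ 2 + (u r - w r) ^ 2) * Real.exp (-((K + 1) * r))
  have hd : ∀ r, 0 < r → HasDerivAt H
      ((2 * (v r - z r) * (-(n / r * (v r - z r)) - (g (u r) - g (w r)))
        + 2 * (u r - w r) * (v r - z r)
        - (K + 1) * ((v r - z r) ^ 2 + (u r - w r) ^ 2)) * Real.exp (-((K + 1) * r))) r := by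
    intro r hr
    have h1 := ((h.hasDerivAt_snd r hr).sub (h'.hasDerivAt_snd r hr)).pow 2
    have h2 := ((h.hasDerivAt_fst r hr).sub (h'.hasDerivAt_fst r hr)).pow 2
    have h3 := (((hasDerivAt_id r).const_mul ((K : ℝ) + 1)).neg).exp
    refine ((h1.add h2).mul h3).congr_deriv ?_
    simp only [Pi.add_apply, Pi.sub_apply, Pi.pow_apply, Pi.neg_apply, id]
    push_cast
    ring
  have hanti : AntitoneOn H (Ici 0) := by
    refine antitoneOn_of_deriv_nonpos (convex_Ici 0) ?_ ?_ ?_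
    · exact (((h.continuousOn_snd.sub h'.continuousOn_snd).pow 2).add
        ((h.continuousOn_fst.sub h'.continuousOn_fst).pow 2)).mul
        (by fun_prop)
    · rw [interior_Ici]
      exact fun r hr => (hd r hr).differentiableAt.differentiableWithinAt
    · rw [interior_Ici]
      intro r hr
      rw [(hd r hr).deriv]
      refine mul_nonpos_of_nonpos_of_nonneg ?_ (Real.exp_pos _).le
      have hr' : 0 < r := hr
      have hK : |g (u r) - g (w r)| ≤ K * |u r - w r| := by
        simpa [Real.dist_eq] using hg.dist_le_mul (u r) (w r)
      have hK0 : (0 : ℝ) ≤ K := K.2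
      have h1 : 0 ≤ n / r * (v r - z r) ^ 2 := by positivity
      have h2 : |(v r - z r) * (g (u r) - g (w r))| ≤ K * (|u r - w r| * |v r - z r|) := by
        rw [abs_mul]
        nlinarith [abs_nonneg (v r - z r)]
      have h3 := neg_abs_le ((v r - z r) * (g (u r) - g (w r)))
      have h4 : (u r - w r) * (v r - z r) ≤ |u r - w r| * |v r - z r| := by
        rw [← abs_mul]; exact le_abs_self _
      have h5 : 2 * (|u r - w r| * |v r - z r|) ≤ (v r - z r) ^ 2 + (u r - w r) ^ 2 := by
        rw [← sq_abs (v r - z r), ← sq_abs (u r - w r)]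
        nlinarith [sq_nonneg (|v r - z r| - |u r - w r|)]
      nlinarith [mul_le_mul_of_nonneg_left h5 hK0]
  intro r hr
  have h0 := hanti (mem_Ici.2 le_rfl) hr hr
  simp only [H, h.fst_zero, h'.fst_zero, h.snd_zero, h'.snd_zero, sub_self] at h0
  have h1 : (v r - z r) ^ 2 + (u r - w r) ^ 2 ≤ 0 := by
    by_contra! hlt
    have := mul_pos hlt (Real.exp_pos (-((K + 1) * r)))
    norm_num at h0
    linarith
  have : (u r - w r) ^ 2 = 0 := le_antisymm (by nlinarith [sq_nonneg (v r - z r)]) (sq_nonneg _)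
  linarith [pow_eq_zero_iff two_ne_zero |>.1 this]

end RadialODE

lemma IsRadialSolution.radialODE {n : ℕ} {θ a : ℝ} {w : ℝ → ℝ}
    (h : IsRadialSolution (n + 1) θ a w) :
    RadialODE n (nonlinearity θ) a w (derivWithin w (Ici 0)) := by
  have he : ∀ r, 0 < r → derivWithin w (Ici 0) r = deriv w r := fun r hr =>
    derivWithin_of_mem_nhds (Ici_mem_nhds hr)
  have h2 : ContDiffOn ℝ 1 (deriv w) (Ioi 0) :=
    ((contDiffOn_succ_iff_deriv_of_isOpen (n := 1) isOpen_Ioi).1 h.contDiffOn_two).2.2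
  refine ⟨h.contDiffOn_one.continuousOn,
    h.contDiffOn_one.continuousOn_derivWithin (uniqueDiffOn_Ici 0) le_rfl, h.value_zero,
    h.deriv_zero.derivWithin (uniqueDiffOn_Ici 0 0 (mem_Ici.2 le_rfl)), ?_, ?_⟩
  · intro r hr
    rw [he r hr]
    exact ((h.contDiffOn_two.differentiableOn two_ne_zero).differentiableAt
      (Ioi_mem_nhds hr)).hasDerivAt
  · intro r hr
    have h3 : HasDerivAt (deriv w) (deriv (deriv w) r) r :=
      ((h2.differentiableOn one_ne_zero).differentiableAt (Ioi_mem_nhds hr)).hasDerivAt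
    have h4 : derivWithin w (Ici 0) =ᶠ[𝓝 r] deriv w := by
      filter_upwards [Ioi_mem_nhds hr] with x hx using he x hx
    refine (h3.congr_of_eventuallyEq h4).congr_deriv ?_
    have := h.equation r hr
    push_cast at this
    rw [he r hr, nonlinearity]
    linear_combination this

/-- The average `∫₀¹ τⁿ g(u(rτ)) dτ`, so that `-r` times it is the derivative at `r` of a radial
solution. -/
def radialMean (n : ℕ) (g u : ℝ → ℝ) (r : ℝ) : ℝ :=
  ∫ τ in (0 : ℝ)..1, τ ^ n * g (u (r * τ))

lemma continuous_radialMean (n : ℕ) {g u : ℝ → ℝ} (hg : Continuous g) (hu : Continuous u) :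
    Continuous (radialMean n g u) :=
  intervalIntegral.continuous_parametric_intervalIntegral_of_continuous' (by fun_prop) 0 1

lemma abs_radialMean_le (n : ℕ) {g u : ℝ → ℝ} {C : ℝ} (hC : ∀ s, |g s| ≤ C) (r : ℝ) :
    |radialMean n g u r| ≤ C := by
  have h := intervalIntegral.norm_integral_le_of_norm_le_const (a := 0) (b := 1) (C := C)
    (f := fun τ : ℝ => τ ^ n * g (u (r * τ))) ?_
  · simpa [radialMean] using h
  · intro τ hτ
    rw [uIoc_of_le zero_le_one] at hτ
    rw [norm_mul, norm_pow, Real.norm_eq_abs, abs_of_pos hτ.1, Real.norm_eq_abs]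
    calc τ ^ n * |g (u (r * τ))| ≤ 1 * |g (u (r * τ))| := by
          gcongr; exact pow_le_one₀ hτ.1.le hτ.2
      _ ≤ C := by rw [one_mul]; exact hC _

lemma abs_radialMean_sub_le (n : ℕ) {g u w : ℝ → ℝ} {K : NNReal} {l D : ℝ}
    (hg : LipschitzWith K g) (hu : Continuous u) (hw : Continuous w) (hl : 0 ≤ l)
    (hD : ∀ t, |u t - w t| ≤ D * Real.exp (l * t ^ 2)) (r : ℝ) :
    |radialMean n g u r - radialMean n g w r| ≤ K * D * Real.exp (l * r ^ 2) := by
  have hg' := hg.continuous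
  have hD0 : 0 ≤ D := by simpa using (abs_nonneg _).trans (hD 0)
  rw [radialMean, radialMean, ← intervalIntegral.integral_sub
    (Continuous.intervalIntegrable (by fun_prop) _ _)
    (Continuous.intervalIntegrable (by fun_prop) _ _)]
  have h := intervalIntegral.norm_integral_le_of_norm_le_const (a := 0) (b := 1)
    (C := K * D * Real.exp (l * r ^ 2))
    (f := fun τ : ℝ => τ ^ n * g (u (r * τ)) - τ ^ n * g (w (r * τ))) ?_
  · simpa using h
  · intro τ hτ
    rw [uIoc_of_le zero_le_one] at hτ
    rw [← mul_sub, norm_mul, norm_pow, Real.norm_eq_abs, abs_of_pos hτ.1, Real.norm_eq_abs]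
    have h1 : |g (u (r * τ)) - g (w (r * τ))| ≤ K * |u (r * τ) - w (r * τ)| := by
      simpa [Real.dist_eq] using hg.dist_le_mul (u (r * τ)) (w (r * τ))
    have h2 : (r * τ) ^ 2 ≤ r ^ 2 := by
      rw [mul_pow]
      exact mul_le_of_le_one_right (sq_nonneg r) (pow_le_one₀ hτ.1.le hτ.2)
    calc τ ^ n * |g (u (r * τ)) - g (w (r * τ))| ≤ 1 * |g (u (r * τ)) - g (w (r * τ))| := by
          gcongr; exact pow_le_one₀ hτ.1.le hτ.2
      _ ≤ K * (D * Real.exp (l * (r * τ) ^ 2)) := by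
          rw [one_mul]; exact h1.trans (by gcongr; exact hD _)
      _ ≤ K * (D * Real.exp (l * r ^ 2)) := by gcongr
      _ = _ := by ring

lemma integral_mul_exp_sq {l : ℝ} (hl : 0 < l) (r : ℝ) :
    ∫ s in (0 : ℝ)..r, s * Real.exp (l * s ^ 2) = (Real.exp (l * r ^ 2) - 1) / (2 * l) := by
  have h : ∀ s ∈ uIcc 0 r, HasDerivAt (fun s => Real.exp (l * s ^ 2) / (2 * l))
      (s * Real.exp (l * s ^ 2)) s := by
    intro s _
    refine ((((hasDerivAt_pow 2 s).const_mul l).exp).div_const (2 * l)).congr_deriv ?_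
    field_simp
    push_cast
    ring
  rw [intervalIntegral.integral_eq_sub_of_hasDerivAt h
    (Continuous.intervalIntegrable (by fun_prop) _ _)]
  simp
  ring

lemma abs_integral_mul_le {k : ℝ → ℝ} {l C : ℝ} (hl : 0 < l)
    (hk : ∀ s, |k s| ≤ C * Real.exp (l * s ^ 2)) (r : ℝ) :
    |∫ s in (0 : ℝ)..r, s * k s| ≤ C * Real.exp (l * r ^ 2) / (2 * l) := by
  have hC : 0 ≤ C := by simpa using (abs_nonneg _).trans (hk 0)
  obtain ⟨σ, hσ, hs⟩ : ∃ σ : ℝ, |σ| = 1 ∧ ∀ s ∈ uIoc 0 r, |s| = σ * s := by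
    rcases le_total 0 r with h | h
    · refine ⟨1, by simp, fun s hs => ?_⟩
      rw [uIoc_of_le h] at hs
      rw [abs_of_pos hs.1, one_mul]
    · refine ⟨-1, by simp, fun s hs => ?_⟩
      rw [uIoc_of_ge h] at hs
      rw [abs_of_nonpos hs.2]; ring
  have h := intervalIntegral.norm_integral_le_abs_of_norm_le (μ := MeasureTheory.volume)
    (a := 0) (b := r) (f := fun s => s * k s) (g := fun s => σ * C * (s * Real.exp (l * s ^ 2)))
    (MeasureTheory.ae_restrict_of_forall_mem measurableSet_uIoc fun s hsr => ?_)
    (Continuous.intervalIntegrable (by fun_prop) _ _)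
  · rw [intervalIntegral.integral_const_mul, integral_mul_exp_sq hl, abs_mul, abs_mul, hσ, one_mul,
      abs_of_nonneg hC, Real.norm_eq_abs,
      abs_of_nonneg (a := (Real.exp (l * r ^ 2) - 1) / (2 * l))] at h
    · refine h.trans ?_
      rw [mul_div_assoc]
      gcongr
      linarith
    · have : 1 ≤ Real.exp (l * r ^ 2) := Real.one_le_exp (by positivity)
      exact div_nonneg (by linarith) (by linarith)
  · rw [norm_mul, Real.norm_eq_abs, hs s hsr, Real.norm_eq_abs]
    have h0 : 0 ≤ σ * s := hs s hsr ▸ abs_nonneg s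
    calc σ * s * |k s| ≤ σ * s * (C * Real.exp (l * s ^ 2)) := by gcongr; exact hk s
      _ = _ := by ring

/-- Existence of a fixed point of the radial integral equation for bounded Lipschitz `g`. -/
lemma exists_radial_fixedPoint (n : ℕ) {g : ℝ → ℝ} {K : NNReal} {C : ℝ} (hg : LipschitzWith K g)
    (hC : ∀ s, |g s| ≤ C) (a : ℝ) :
    ∃ u : ℝ → ℝ, Continuous u ∧ ∀ r, u r = a - ∫ s in (0 : ℝ)..r, s * radialMean n g u s := by
  set l : ℝ := K + 1
  have hl : 0 < l := by positivity
  have hg' := hg.continuous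
  have hC0 : 0 ≤ C := (abs_nonneg _).trans (hC 0)
  let U : BoundedContinuousFunction ℝ ℝ → ℝ → ℝ := fun w r => Real.exp (l * r ^ 2) * w r
  have hU : ∀ w, Continuous (U w) := fun w => by
    have := w.continuous
    fun_prop
  have hint : ∀ w, Continuous fun s => s * radialMean n g (U w) s := fun w =>
    continuous_id.mul (continuous_radialMean n hg' (hU w))
  let T : BoundedContinuousFunction ℝ ℝ → ℝ → ℝ := fun w r =>
    Real.exp (-(l * r ^ 2)) * (a - ∫ s in (0 : ℝ)..r, s * radialMean n g (U w) s)
  have hT : ∀ w, Continuous (T w) := fun w => by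
    have := intervalIntegral.continuous_primitive
      (fun a b => (hint w).intervalIntegrable (μ := MeasureTheory.volume) a b) 0
    fun_prop
  have hTb : ∀ w r, ‖T w r‖ ≤ |a| + C / (2 * l) := by
    intro w r
    have h1 : |∫ s in (0 : ℝ)..r, s * radialMean n g (U w) s|
        ≤ C * Real.exp (l * r ^ 2) / (2 * l) := by
      refine abs_integral_mul_le hl (fun s => (abs_radialMean_le n hC s).trans ?_) r
      exact le_mul_of_one_le_right hC0 (Real.one_le_exp (by positivity))
    have h2 : Real.exp (-(l * r ^ 2)) ≤ 1 := Real.exp_le_one_iff.2 (by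
      have : 0 ≤ l * r ^ 2 := by positivity
      linarith)
    rw [norm_mul, Real.norm_eq_abs, abs_of_pos (Real.exp_pos _), Real.norm_eq_abs]
    calc Real.exp (-(l * r ^ 2)) * |a - ∫ s in (0 : ℝ)..r, s * radialMean n g (U w) s|
        ≤ Real.exp (-(l * r ^ 2)) * (|a| + C * Real.exp (l * r ^ 2) / (2 * l)) := by
          gcongr
          exact (abs_sub _ _).trans (by gcongr)
      _ = Real.exp (-(l * r ^ 2)) * |a| + C / (2 * l) := by
          rw [mul_add, Real.exp_neg]
          field_simp
      _ ≤ _ := by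
          gcongr
          exact mul_le_of_le_one_left (abs_nonneg a) h2
  let S : BoundedContinuousFunction ℝ ℝ → BoundedContinuousFunction ℝ ℝ := fun w =>
    BoundedContinuousFunction.ofNormedAddCommGroup (T w) (hT w) _ (hTb w)
  have hS : ContractingWith (1 / 2) S := by
    refine ⟨by rw [← NNReal.coe_lt_coe]; norm_num, LipschitzWith.of_dist_le_mul fun w z => ?_⟩
    refine (BoundedContinuousFunction.dist_le (by positivity)).2 fun r => ?_
    have h0 : ∀ t, |U w t - U z t| ≤ dist w z * Real.exp (l * t ^ 2) := by
      intro t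
      simp only [U]
      rw [← mul_sub, abs_mul, abs_of_pos (Real.exp_pos _), mul_comm]
      gcongr
      rw [← Real.dist_eq]
      exact BoundedContinuousFunction.dist_coe_le_dist t
    have h1 := abs_integral_mul_le hl
      (k := fun s => radialMean n g (U w) s - radialMean n g (U z) s)
      (fun s => abs_radialMean_sub_le n hg (hU w) (hU z) hl.le h0 s) r
    have h2 : ∫ s in (0 : ℝ)..r, s * (radialMean n g (U w) s - radialMean n g (U z) s)
        = (∫ s in (0 : ℝ)..r, s * radialMean n g (U w) s)
          - ∫ s in (0 : ℝ)..r, s * radialMean n g (U z) s := by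
      rw [← intervalIntegral.integral_sub ((hint w).intervalIntegrable _ _)
        ((hint z).intervalIntegrable _ _)]
      simp only [mul_sub]
    rw [h2] at h1
    change dist (T w r) (T z r) ≤ _
    rw [Real.dist_eq]
    simp only [T]
    rw [← mul_sub, abs_mul, abs_of_pos (Real.exp_pos _), sub_sub_sub_cancel_left, abs_sub_comm]
    calc _ ≤ Real.exp (-(l * r ^ 2)) * (K * dist w z * Real.exp (l * r ^ 2) / (2 * l)) := by
          gcongr
      _ = K / l * (1 / 2) * dist w z := by
          rw [Real.exp_neg]
          field_simp
      _ ≤ 1 * (1 / 2) * dist w z := by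
          gcongr
          rw [div_le_one hl]
          simp [l]
      _ = _ := by simp
  refine ⟨U (hS.fixedPoint S), hU _, fun r => ?_⟩
  have h := congrArg (fun w : BoundedContinuousFunction ℝ ℝ => Real.exp (l * r ^ 2) * w r)
    hS.fixedPoint_isFixedPt.eq
  change Real.exp (l * r ^ 2) * T (hS.fixedPoint S) r = U (hS.fixedPoint S) r at h
  rw [← h]
  simp only [T]
  rw [← mul_assoc, ← Real.exp_add]
  simp

lemma pow_mul_radialMean (n : ℕ) (g u : ℝ → ℝ) (r : ℝ) :
    r ^ n * (r * radialMean n g u r) = ∫ t in (0 : ℝ)..r, t ^ n * g (u t) := by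
  have h := intervalIntegral.mul_integral_comp_mul_left (a := 0) (b := 1)
    (f := fun t => t ^ n * g (u t)) r
  rw [mul_zero, mul_one] at h
  rw [← h, radialMean, mul_left_comm, ← intervalIntegral.integral_const_mul]
  simp only [mul_pow, mul_assoc]

lemma hasDerivAt_mul_radialMean (n : ℕ) {g u : ℝ → ℝ} (hg : Continuous g) (hu : Continuous u)
    (r : ℝ) :
    HasDerivAt (fun r => r * radialMean n g u r) (g (u r) - n * radialMean n g u r) r := by
  rcases eq_or_ne r 0 with rfl | hr
  · have h0 : radialMean n g u 0 = g (u 0) / (n + 1) := by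
      simp only [radialMean, zero_mul]
      rw [intervalIntegral.integral_mul_const, integral_pow]
      simp
      ring
    have h1 : g (u 0) - n * radialMean n g u 0 = radialMean n g u 0 := by
      rw [h0]
      field_simp
      ring
    rw [h1, hasDerivAt_iff_tendsto_slope]
    have h2 := ((continuous_radialMean n hg hu).tendsto 0).mono_left
      (nhdsWithin_le_nhds (s := {0}ᶜ))
    refine h2.congr' ?_
    filter_upwards [self_mem_nhdsWithin] with x hx
    have : x ≠ 0 := hx
    simp [slope_def_field, this]
  · have hP : HasDerivAt (fun r => ∫ t in (0 : ℝ)..r, t ^ n * g (u t)) (r ^ n * g (u r)) r := by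
      have hc : Continuous fun t => t ^ n * g (u t) := by fun_prop
      exact intervalIntegral.integral_hasDerivAt_right (hc.intervalIntegrable _ _)
        (hc.stronglyMeasurableAtFilter _ _) hc.continuousAt
    have hq := hP.div (hasDerivAt_pow n r) (pow_ne_zero n hr)
    have he : (fun r => r * radialMean n g u r) =ᶠ[𝓝 r]
        (fun r => ∫ t in (0 : ℝ)..r, t ^ n * g (u t)) / fun r => r ^ n := by
      filter_upwards [isOpen_ne.mem_nhds hr] with x hx
      simp only [Pi.div_apply]
      rw [← pow_mul_radialMean, mul_div_cancel_left₀ _ (pow_ne_zero n hx)]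
    refine (hq.congr_of_eventuallyEq he).congr_deriv ?_
    rw [← pow_mul_radialMean]
    rcases n with _ | m
    · simp
    · simp only [Nat.add_sub_cancel]
      field_simp
      ring

/-- Global existence of a `C²` radial solution for bounded Lipschitz `g`. -/
lemma exists_radialODE (n : ℕ) {g : ℝ → ℝ} {K : NNReal} {C : ℝ} (hg : LipschitzWith K g)
    (hC : ∀ s, |g s| ≤ C) (a : ℝ) :
    ∃ u : ℝ → ℝ, ContDiff ℝ 2 u ∧ RadialODE n g a u (deriv u) := by
  obtain ⟨u, huc, hu⟩ := exists_radial_fixedPoint n hg hC a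
  have hg' := hg.continuous
  have hm := continuous_radialMean n hg' huc
  have hd : ∀ r, HasDerivAt u (-(r * radialMean n g u r)) r := by
    intro r
    have hc : Continuous fun s => s * radialMean n g u s := by fun_prop
    have h := (intervalIntegral.integral_hasDerivAt_right (hc.intervalIntegrable 0 r)
      (hc.stronglyMeasurableAtFilter _ _) hc.continuousAt).const_sub a
    rwa [← funext hu] at h
  have hd1 : deriv u = fun r => -(r * radialMean n g u r) := funext fun r => (hd r).deriv
  have hd2 : ∀ r, HasDerivAt (deriv u) (-(g (u r) - n * radialMean n g u r)) r := fun r => by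
    rw [hd1]
    exact (hasDerivAt_mul_radialMean n hg' huc r).neg
  have h1 : ContDiff ℝ 1 (deriv u) := by
    rw [contDiff_one_iff_deriv]
    refine ⟨fun r => (hd2 r).differentiableAt, ?_⟩
    rw [funext fun r => (hd2 r).deriv]
    fun_prop
  refine ⟨u, ?_, huc.continuousOn, h1.continuous.continuousOn, by simp [hu 0], by simp [hd1],
    fun r _ => (hd r).differentiableAt.hasDerivAt, fun r hr => (hd2 r).congr_deriv ?_⟩
  · refine (contDiff_succ_iff_deriv (n := 1)).2 ⟨fun r => (hd r).differentiableAt, by simp, h1⟩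
  · rw [hd1]
    field_simp
    ring

lemma mul_sq_le_nonlinearity_mul {θ b s : ℝ} (h₀ : 0 < θ) (h₁ : θ < 1 / 2) (hb : 0 < b)
    (hb1 : b < 1) (hs : b < s) :
    2 * θ * b * (s - 1) ^ 2 ≤ nonlinearity θ s * (s - 1) := by
  have hs0 : 0 < s := hb.trans hs
  rcases le_total 1 s with h | h
  · have h2 : s ^ (1 - 2 * θ) = s * s ^ (-(2 * θ)) := by
      rw [sub_eq_add_neg, Real.rpow_add hs0, Real.rpow_one]
    have h3 := rpow_one_add_le_one_add_mul_self (s := s - 1) (by linarith)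
      (p := 1 - 2 * θ) (by linarith) (by linarith)
    rw [add_sub_cancel, h2] at h3
    have h4 : 2 * θ * (s - 1) ≤ nonlinearity θ s := by
      rw [nonlinearity_of_pos hs0]; linarith
    have h5 : 2 * θ * b ≤ 2 * θ := by nlinarith
    nlinarith [mul_le_mul_of_nonneg_right h4 (sub_nonneg.2 h), sq_nonneg (s - 1)]
  · have h2 : 2 * θ * (1 - s) ≤ s ^ (-(2 * θ)) - 1 := by
      have h3 := Real.add_one_le_exp (Real.log s * -(2 * θ))
      rw [← Real.rpow_def_of_pos hs0] at h3
      nlinarith [Real.log_le_sub_one_of_pos hs0]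
    have h3 : 2 * θ * b * (1 - s) ≤ -nonlinearity θ s := by
      rw [nonlinearity_of_pos hs0]
      have : 0 ≤ s ^ (-(2 * θ)) - 1 := le_trans (by nlinarith) h2
      nlinarith
    nlinarith

namespace RadialODE

variable {n : ℕ} {g : ℝ → ℝ} {θ a b c q : ℝ} {u v : ℝ → ℝ}

/-- A solution with `a > 1` has no common zero of `u - 1` and `u'`, since `r ^ (2 n)` times the
energy is nondecreasing. -/
lemma snd_ne_zero (h : RadialODE n (nonlinearity θ) a u v) (h₀ : 0 < θ) (h₁ : θ < 1 / 2)
    (ha : 1 < a) (hu : ∀ r, 0 ≤ r → 0 < u r) {r : ℝ} (hr : 0 < r) (h1 : u r = 1) : v r ≠ 0 := by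
  intro hv
  set E : ℝ → ℝ := fun r => v r ^ 2 / 2 + (potentialF θ (u r) - potentialF θ 1)
  have hEc : ContinuousOn E (Ici 0) :=
    ((h.continuousOn_snd.pow 2).div_const 2).add
      (((continuous_potentialF h₁).comp_continuousOn h.continuousOn_fst).sub continuousOn_const)
  have hd : ∀ r, 0 < r → HasDerivAt (fun r => r ^ (2 * n) * E r)
      (r ^ (2 * n) * (2 * n / r * (potentialF θ (u r) - potentialF θ 1))) r := by
    intro r hr
    have hE : HasDerivAt E (-(n / r * v r ^ 2)) r := by
      refine ((((h.hasDerivAt_snd r hr).pow 2).div_const 2).add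
        (((hasDerivAt_potentialF h₁ (u r)).comp r (h.hasDerivAt_fst r hr)).sub_const _)).congr_deriv
        ?_
      push_cast
      ring
    refine ((hasDerivAt_pow (2 * n) r).mul hE).congr_deriv ?_
    rcases n with _ | m
    · simp
    · simp only [E, show 2 * (m + 1) = 2 * m + 1 + 1 by ring]
      push_cast
      field_simp
      ring
  have hmono : MonotoneOn (fun r => r ^ (2 * n) * E r) (Ici 0) := by
    refine monotoneOn_of_deriv_nonneg (convex_Ici 0) ((continuousOn_pow _).mul hEc) ?_ ?_
    · rw [interior_Ici]
      exact fun r hr => (hd r hr).differentiableAt.differentiableWithinAt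
    · rw [interior_Ici]
      intro r hr
      have hr' : 0 < r := hr
      rw [(hd r hr).deriv]
      have := sub_nonneg.2 (potentialF_one_le h₀ h₁ (hu r hr'.le))
      positivity
  have hE0 : 0 < E 0 := by
    have := potentialF_strictMonoOn h₀ h₁ (mem_Ici.2 le_rfl) ha.le ha
    simp only [E, h.fst_zero, h.snd_zero]
    linarith
  have hev : ∀ᶠ x in 𝓝[>] (0 : ℝ), 0 < E x ∧ x ∈ Ioo 0 r :=
    (((hEc 0 (mem_Ici.2 le_rfl)).mono Ioi_subset_Ici_self).eventually (lt_mem_nhds hE0)).and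
      (Ioo_mem_nhdsGT hr)
  obtain ⟨x, hx, hx0, hxr⟩ := hev.exists
  have := hmono (mem_Ici.2 hx0.le) (mem_Ici.2 hr.le) hxr.le
  simp only [E, h1, hv] at this
  have h2 := mul_pos (pow_pos hx0 (2 * n)) hx
  simp only [E] at h2
  norm_num at this
  linarith

/-- Sturm-type oscillation: `u` takes the value `c` beyond every radius. -/
lemma exists_eq (h : RadialODE n g a u v) (hq : 0 < q)
    (hg : ∀ r, 0 < r → q * (u r - c) ^ 2 ≤ g (u r) * (u r - c)) (R : ℝ) :
    ∃ x, R < x ∧ u x = c := by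
  by_contra! hne
  set κ := Real.sqrt q
  have hκ : 0 < κ := Real.sqrt_pos.2 hq
  have hκ2 : κ ^ 2 = q := Real.sq_sqrt hq.le
  obtain ⟨R₁, hR₁, hR, hn⟩ : ∃ R₁, 0 < R₁ ∧ R < R₁ ∧ n / κ ≤ R₁ := by
    refine ⟨max (n / κ) |R| + 1, ?_, ?_, ?_⟩
    · have := abs_nonneg R
      linarith [le_max_right (n / κ) |R|]
    · linarith [le_max_right (n / κ) |R|, le_abs_self R]
    · linarith [le_max_left (n / κ) |R|]
  set A : ℝ → ℝ := fun r => Real.arctan (v r / (u r - c) / κ) + κ / 2 * r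
  have hd : ∀ r ∈ Ici R₁, ∃ A', HasDerivAt A A' r ∧ A' ≤ 0 := by
    intro r hr
    have hr1 : R₁ ≤ r := hr
    have hr0 : 0 < r := hR₁.trans_le hr
    have hw : u r - c ≠ 0 := sub_ne_zero.2 (hne r (hR.trans_le hr))
    refine ⟨_, ((((h.hasDerivAt_snd r hr0).div ((h.hasDerivAt_fst r hr0).sub_const c)
      hw).div_const κ).arctan).add ((hasDerivAt_id r).const_mul (κ / 2)), ?_⟩
    set y := v r / (u r - c) with hy
    have hvy : v r = y * (u r - c) := by rw [hy]; field_simp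
    have hnr : n / r ≤ κ := by
      rw [div_le_iff₀ hr0]
      rw [div_le_iff₀ hκ] at hn
      nlinarith
    have hnr0 : 0 ≤ n / r := by positivity
    have hQ : q ≤ g (u r) / (u r - c) := by
      rw [← mul_div_mul_right _ _ hw, ← sq, le_div_iff₀ (by positivity)]
      exact hg r hr0
    have hy' : ((-(n / r * v r) - g (u r)) * (u r - c) - v r * v r) / (u r - c) ^ 2
        = -(n / r * y) - g (u r) / (u r - c) - y ^ 2 := by
      rw [hvy]
      field_simp
    have hle : ((-(n / r * v r) - g (u r)) * (u r - c) - v r * v r) / (u r - c) ^ 2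
        ≤ -(κ ^ 2 + y ^ 2) / 2 := by
      rw [hy']
      nlinarith [sq_nonneg (n / r + y), mul_self_le_mul_self hnr0 hnr]
    simp only [Pi.div_apply, mul_one]
    rw [← hy]
    have h1 : 1 / (1 + (y / κ) ^ 2) * (-(κ ^ 2 + y ^ 2) / 2 / κ) = -(κ / 2) := by
      field_simp
    have h2 : 1 / (1 + (y / κ) ^ 2) *
        (((-(n / r * v r) - g (u r)) * (u r - c) - v r * v r) / (u r - c) ^ 2 / κ)
        ≤ 1 / (1 + (y / κ) ^ 2) * (-(κ ^ 2 + y ^ 2) / 2 / κ) := by gcongr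
    linarith
  have hanti : AntitoneOn A (Ici R₁) := by
    refine antitoneOn_of_deriv_nonpos (convex_Ici R₁) ?_ ?_ ?_
    · intro r hr
      obtain ⟨_, h1, _⟩ := hd r hr
      exact h1.continuousAt.continuousWithinAt
    · intro r hr
      obtain ⟨_, h1, _⟩ := hd r (interior_subset hr)
      exact h1.differentiableAt.differentiableWithinAt
    · intro r hr
      obtain ⟨_, h1, h2⟩ := hd r (interior_subset hr)
      rwa [h1.deriv]
  have hle : R₁ ≤ R₁ + 2 * Real.pi / κ := by
    have := Real.pi_pos
    have : 0 < 2 * Real.pi / κ := by positivity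
    linarith
  have h1 := hanti (mem_Ici.2 le_rfl) (mem_Ici.2 hle) hle
  simp only [A] at h1
  have h2 := Real.arctan_lt_pi_div_two (v R₁ / (u R₁ - c) / κ)
  have h3 := Real.neg_pi_div_two_lt_arctan
    (v (R₁ + 2 * Real.pi / κ) / (u (R₁ + 2 * Real.pi / κ) - c) / κ)
  have h4 : κ / 2 * (R₁ + 2 * Real.pi / κ) = κ / 2 * R₁ + Real.pi := by
    field_simp
  linarith

/-- Between two critical points `u` passes through a zero of `g`. -/
lemma exists_zero_between (h : RadialODE n g a u v) {x y : ℝ} (hx : 0 ≤ x) (hxy : x < y)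
    (hvx : v x = 0) (hvy : v y = 0) : ∃ z ∈ Ioo x y, g (u z) = 0 := by
  obtain ⟨z, hz, hz0⟩ := exists_hasDerivAt_eq_zero (f := fun r => r ^ n * v r)
    (f' := fun r => -(r ^ n * g (u r))) hxy
    ((continuousOn_pow n).mul (h.continuousOn_snd.mono fun r hr => hx.trans hr.1))
    (by simp [hvx, hvy]) (fun r hr => by
      have hr0 : 0 < r := hx.trans_lt hr.1
      refine ((hasDerivAt_pow n r).mul (h.hasDerivAt_snd r hr0)).congr_deriv ?_
      rcases n with _ | m
      · simp
      · simp only [Nat.add_sub_cancel]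
        push_cast
        field_simp
        ring)
  have hz' : z ^ n ≠ 0 := pow_ne_zero n (hx.trans_lt hz.1).ne'
  exact ⟨z, hz, by simpa [hz'] using hz0⟩

end RadialODE

/-- The level set of a function without degenerate crossings is enumerated by a sequence. -/
lemma exists_crossing_sequence {u v : ℝ → ℝ} {c : ℝ} (hc : ContinuousOn u (Ici 0)) (h0 : u 0 ≠ c)
    (hd : ∀ r, 0 < r → HasDerivAt u (v r) r) (hv : ∀ r, 0 < r → u r = c → v r ≠ 0)
    (hex : ∀ R, ∃ x, R < x ∧ u x = c) :
    ∃ r : ℕ → ℝ, 0 < r 0 ∧ StrictMono r ∧ Tendsto r atTop atTop ∧ (∀ k, u (r k) = c) ∧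
      (∀ x ∈ Ioo 0 (r 0), u x ≠ c) ∧ (∀ k, ∀ x ∈ Ioo (r k) (r (k + 1)), u x ≠ c) ∧
      ∀ x, 0 < x → x < r 0 ∨ ∃ k, r k ≤ x ∧ x < r (k + 1) := by
  have hiso : ∀ x, 0 ≤ x → ∀ᶠ z in 𝓝[>] x, u z ≠ c := by
    intro x hx
    by_cases hxc : u x = c
    · have hx0 : 0 < x := hx.lt_of_ne (by rintro rfl; exact h0 hxc)
      exact ((hd x hx0).eventually_ne (hv x hx0 hxc)).filter_mono
        (nhdsWithin_mono _ fun z hz => (mem_Ioi.1 hz).ne')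
    · exact ((hc x hx).mono fun z hz => hx.trans (mem_Ioi.1 hz).le).eventually
        (isOpen_ne.mem_nhds hxc)
  have hnext : ∀ x, ∃ y, 0 ≤ x → x < y ∧ u y = c ∧ ∀ z ∈ Ioo x y, u z ≠ c := by
    intro x
    by_cases hx : 0 ≤ x
    swap
    · exact ⟨0, fun h => absurd h hx⟩
    obtain ⟨e, he, hxe⟩ := (mem_nhdsGT_iff_exists_Ioo_subset).1 (hiso x hx)
    have he' : x < e := he
    set m := (x + e) / 2
    have hxm : x < m := by simp only [m]; linarith
    have hme : m < e := by simp only [m]; linarith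
    set S := Ici m ∩ u ⁻¹' {c}
    have hS : IsClosed S :=
      (hc.mono fun z hz => hx.trans (hxm.le.trans hz)).preimage_isClosed_of_isClosed
        isClosed_Ici isClosed_singleton
    obtain ⟨z₀, hz₀, hz₀c⟩ := hex m
    have hbdd : BddBelow S := ⟨m, fun z hz => hz.1⟩
    have hmem := hS.csInf_mem ⟨z₀, hz₀.le, hz₀c⟩ hbdd
    refine ⟨sInf S, fun _ => ⟨hxm.trans_le hmem.1, hmem.2, fun z hz hzc => ?_⟩⟩
    rcases lt_or_ge z e with h | h
    · exact hxe ⟨hz.1, h⟩ hzc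
    · exact absurd (csInf_le hbdd ⟨hme.le.trans h, hzc⟩) (not_le.2 hz.2)
  choose N hN using hnext
  let r : ℕ → ℝ := fun k => Nat.rec (N 0) (fun _ y => N y) k
  have hr0 : r 0 = N 0 := rfl
  have hrs : ∀ k, r (k + 1) = N (r k) := fun k => rfl
  have hpos : ∀ k, 0 < r k := by
    intro k
    induction k with
    | zero => exact (hN 0 le_rfl).1
    | succ k ih => rw [hrs]; exact ih.trans (hN _ ih.le).1
  have hmono : StrictMono r := strictMono_nat_of_lt_succ fun k => by
    rw [hrs]; exact (hN _ (hpos k).le).1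
  have hrc : ∀ k, u (r k) = c := by
    intro k
    cases k with
    | zero => exact (hN 0 le_rfl).2.1
    | succ k => rw [hrs]; exact (hN _ (hpos k).le).2.1
  have htend : Tendsto r atTop atTop := by
    refine (tendsto_atTop_of_monotone hmono.monotone).resolve_right ?_
    rintro ⟨l, hl⟩
    have hlt : ∀ k, r k < l := fun k =>
      (hmono (Nat.lt_succ_self k)).trans_le (hmono.monotone.ge_of_tendsto hl (k + 1))
    have hl0 : 0 < l := (hpos 0).trans (hlt 0)
    have hul : u l = c := by
      refine tendsto_nhds_unique ((hd l hl0).continuousAt.tendsto.comp hl) ?_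
      exact tendsto_const_nhds.congr fun k => (hrc k).symm
    have hl' : Tendsto r atTop (𝓝[≠] l) :=
      tendsto_nhdsWithin_iff.2 ⟨hl, Eventually.of_forall fun k => (hlt k).ne⟩
    obtain ⟨k, hk⟩ := (hl'.eventually ((hd l hl0).eventually_ne (c := c) (hv l hl0 hul))).exists
    exact hk (hrc k)
  refine ⟨r, hpos 0, hmono, htend, hrc, (hN 0 le_rfl).2.2, fun k => (hN _ (hpos k).le).2.2,
    fun x hx => ?_⟩
  have hex' : ∃ k, x < r k := (htend.eventually_gt_atTop x).exists
  obtain ⟨m, hm, hmin⟩ : ∃ m, x < r m ∧ ∀ j < m, ¬ x < r j := by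
    classical
    exact ⟨Nat.find hex', Nat.find_spec hex', fun j => Nat.find_min hex'⟩
  rcases m with _ | k
  · exact Or.inl hm
  · exact Or.inr ⟨k, not_lt.1 (hmin k (Nat.lt_succ_self k)), hm⟩

lemma mul_sub_pos_of_forall_ne {u : ℝ → ℝ} {c x y : ℝ} {s : Set ℝ} (hs : s.OrdConnected)
    (hc : ContinuousOn u s) (hne : ∀ z ∈ s, u z ≠ c) (hx : x ∈ s) (hy : y ∈ s) :
    0 < (u x - c) * (u y - c) := by
  by_contra! hle
  have hsub := hs.uIcc_subset hx hy
  have hmem : c ∈ uIcc (u x) (u y) := by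
    rw [mem_uIcc]
    rcases mul_nonpos_iff.1 hle with h | h
    · exact Or.inr ⟨by linarith, by linarith⟩
    · exact Or.inl ⟨by linarith, by linarith⟩
  obtain ⟨z, hz, hzc⟩ := intermediate_value_uIcc (hc.mono hsub) hmem
  exact hne z (hsub hz) hzc

lemma oscillatesAround_of_crossings {u v : ℝ → ℝ} {c : ℝ} (hc : ContinuousOn u (Ici 0))
    (h0 : u 0 ≠ c) (hd : ∀ r, 0 < r → HasDerivAt u (v r) r)
    (hv : ∀ r, 0 < r → u r = c → v r ≠ 0) (hex : ∀ R, ∃ x, R < x ∧ u x = c) (hv0 : v 0 = 0)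
    (hcrit : ∀ x y, 0 ≤ x → x < y → v x = 0 → v y = 0 → ∃ z ∈ Ioo x y, u z = c) :
    OscillatesAround u c := by
  obtain ⟨r, hr0, hmono, htend, hrc, hne0, hne, hcov⟩ := exists_crossing_sequence hc h0 hd hv hex
  have hpos : ∀ k, 0 < r k := fun k => hr0.trans_le (hmono.monotone (Nat.zero_le k))
  have ht : ∀ k, ∃ t ∈ Ioo (r k) (r (k + 1)), v t = 0 := fun k =>
    exists_hasDerivAt_eq_zero (hmono (Nat.lt_succ_self k))
      (hc.mono fun x hx => (hpos k).le.trans hx.1) ((hrc k).trans (hrc (k + 1)).symm)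
      fun x hx => hd x ((hpos k).trans hx.1)
  choose t htmem htv using ht
  have hsign : ∀ k, ∀ x ∈ Ioo (r k) (r (k + 1)), 0 < (u x - c) * (u (t k) - c) := fun k x hx =>
    mul_sub_pos_of_forall_ne ordConnected_Ioo
      (hc.mono fun y hy => (hpos k).le.trans hy.1.le) (hne k) hx (htmem k)
  refine ⟨r, t, hr0, fun k => htmem k, htend, fun x hx => ⟨fun hxc => ?_, ?_⟩,
    fun x hx => ⟨fun hx0 => ?_, ?_⟩, fun k => ?_⟩
  · rcases hcov x hx with h | ⟨k, hk, hk'⟩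
    · exact absurd hxc (hne0 x ⟨hx, h⟩)
    · rcases hk.eq_or_lt with h | h
      · exact ⟨k, h.symm⟩
      · exact absurd hxc (hne k x ⟨h, hk'⟩)
  · rintro ⟨k, rfl⟩
    exact hrc k
  · rw [(hd x hx).deriv] at hx0
    rcases hcov x hx with h | ⟨k, hk, hk'⟩
    · obtain ⟨z, hz, hzc⟩ := hcrit 0 x le_rfl hx hv0 hx0
      exact absurd hzc (hne0 z ⟨hz.1, hz.2.trans h⟩)
    · have hk2 : r k < x := hk.lt_of_ne (by rintro rfl; exact hv _ hx (hrc k) hx0)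
      refine ⟨k, ?_⟩
      rcases lt_trichotomy x (t k) with h | h | h
      · obtain ⟨z, hz, hzc⟩ := hcrit x (t k) hx.le h hx0 (htv k)
        exact absurd hzc (hne k z ⟨hk2.trans hz.1, hz.2.trans (htmem k).2⟩)
      · exact h
      · obtain ⟨z, hz, hzc⟩ := hcrit (t k) x ((hpos k).trans (htmem k).1).le h (htv k) hx0
        exact absurd hzc (hne k z ⟨(htmem k).1.trans hz.1, hz.2.trans hk'⟩)
  · rintro ⟨k, rfl⟩
    rw [(hd _ hx).deriv]
    exact htv k
  · by_contra! hle
    have hk : u (t k) - c ≠ 0 := sub_ne_zero.2 (hne k _ (htmem k))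
    have hk1 : u (t (k + 1)) - c ≠ 0 := sub_ne_zero.2 (hne (k + 1) _ (htmem (k + 1)))
    have hprod : 0 < (u (t k) - c) * (u (t (k + 1)) - c) := hle.lt_of_ne (mul_ne_zero hk hk1).symm
    have hmin : IsLocalMin (fun x => (u x - c) * (u (t k) - c)) (r (k + 1)) := by
      filter_upwards [Ioo_mem_nhds (hmono (Nat.lt_succ_self k))
        (hmono (Nat.lt_succ_self (k + 1)))] with x hx
      simp only [hrc, sub_self, zero_mul]
      rcases lt_trichotomy x (r (k + 1)) with h | rfl | h
      · exact (hsign k x ⟨hx.1, h⟩).le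
      · simp [hrc]
      · have h2 := hsign (k + 1) x ⟨h, hx.2⟩
        have h3 := mul_pos h2 hprod
        have h4 : (u x - c) * (u (t (k + 1)) - c) * ((u (t k) - c) * (u (t (k + 1)) - c))
            = (u x - c) * (u (t k) - c) * (u (t (k + 1)) - c) ^ 2 := by ring
        rw [h4] at h3
        exact (pos_of_mul_pos_left h3 (sq_nonneg _)).le
    have := hmin.hasDerivAt_eq_zero (((hd _ (hpos (k + 1))).sub_const c).mul_const (u (t k) - c))
    exact mul_ne_zero (hv _ (hpos (k + 1)) (hrc (k + 1))) hk this

end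

theorem mainTheorem2 (d : ℕ) (hd : 1 < d) (θ : ℝ) (hθ₀ : 0 < θ) (hθ₁ : θ < 1 / 2) :
    (1 < thresholdP θ ∧ ∀ s : ℝ, 0 < s → (potentialF θ s = 0 ↔ s = thresholdP θ)) ∧
    ∀ a : ℝ, 1 < a → a < thresholdP θ →
      ∃ u : ℝ → ℝ,
        IsRadialSolution d θ a u ∧
        (∀ w : ℝ → ℝ, IsRadialSolution d θ a w → EqOn w u (Ici 0)) ∧
        ContDiffOn ℝ 2 u (Ici 0) ∧
        (∀ r : ℝ, 0 ≤ r → 0 < u r) ∧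
        OscillatesAround u 1 := by
  refine ⟨⟨one_lt_thresholdP hθ₀ hθ₁, fun s hs => potentialF_eq_zero_iff hθ₀ hθ₁ hs⟩, ?_⟩
  intro a ha hap
  obtain ⟨n, rfl⟩ : ∃ n, d = n + 1 := ⟨d - 1, by omega⟩
  obtain ⟨b, hb0, hb1, hFb⟩ := exists_potentialF_gt hθ₀ hθ₁ ha hap
  set p := thresholdP θ
  have hFp : potentialF θ a < potentialF θ p := by
    rw [potentialF_thresholdP hθ₀ hθ₁]
    exact potentialF_neg hθ₀ hθ₁ ha hap
  obtain ⟨g, K, C, hgK, hgC, hgf⟩ := exists_truncation θ hb0 ((hb1.trans ha).trans hap).le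
  obtain ⟨u, huC, hu⟩ := exists_radialODE n hgK hgC a
  have hΦ : ∀ s, HasDerivAt (fun s => ∫ x in a..s, g x) (g s) s := fun s =>
    intervalIntegral.integral_hasDerivAt_right (hgK.continuous.intervalIntegrable _ _)
      (hgK.continuous.stronglyMeasurableAtFilter _ _) hgK.continuous.continuousAt
  have hΦF : ∀ s ∈ Icc b p, ∫ x in a..s, g x = potentialF θ s - potentialF θ a := by
    intro s hs
    refine intervalIntegral.integral_eq_sub_of_hasDerivAt (fun x hx => ?_)
      (hgK.continuous.intervalIntegrable _ _)
    rw [hgf (ordConnected_Icc.uIcc_subset ⟨(hb1.trans ha).le, hap.le⟩ hs hx)]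
    exact hasDerivAt_potentialF hθ₁ x
  have hbp : b ≤ p := ((hb1.trans ha).trans hap).le
  have hmem : ∀ r, 0 ≤ r → u r ∈ Ioo b p := fun r hr => by
    refine hu.mem_Ioo hΦ (hb1.trans ha) hap ?_ ?_ hr
    · rw [intervalIntegral.integral_same, hΦF b ⟨le_rfl, hbp⟩]
      linarith
    · rw [intervalIntegral.integral_same, hΦF p ⟨hbp, le_rfl⟩]
      linarith
  have hpos : ∀ r, 0 ≤ r → 0 < u r := fun r hr => hb0.trans (hmem r hr).1
  have hu' : RadialODE n (nonlinearity θ) a u (deriv u) :=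
    hu.congr fun r hr => hgf (Ioo_subset_Icc_self (hmem r hr.le))
  refine ⟨u, ⟨(huC.of_le one_le_two).contDiffOn, huC.contDiffOn, fun r hr => ?_, hu.fst_zero, ?_⟩,
    fun w hw => ?_, huC.contDiffOn, hpos, ?_⟩
  · rw [(hu'.hasDerivAt_snd r hr).deriv, nonlinearity]
    push_cast
    ring
  · have h := ((huC.differentiable two_ne_zero) 0).hasDerivAt
    rw [hu.snd_zero] at h
    exact h.hasDerivWithinAt
  · have hw' := hw.radialODE
    refine (hw'.congr fun r hr => ?_).eqOn hu hgK
    exact (hgf (Ioo_subset_Icc_self (hw'.mem_Ioo (hasDerivAt_potentialF hθ₁) (hb1.trans ha) hap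
      hFb hFp hr.le))).symm
  · refine oscillatesAround_of_crossings hu'.continuousOn_fst (hu.fst_zero ▸ ha.ne')
      hu'.hasDerivAt_fst (fun r hr h1 => hu'.snd_ne_zero hθ₀ hθ₁ ha hpos hr h1)
      (fun R => hu'.exists_eq (q := 2 * θ * b) (by positivity)
        (fun r hr => mul_sq_le_nonlinearity_mul hθ₀ hθ₁ hb0 hb1 (hmem r hr.le).1) R)
      hu'.snd_zero fun x y hx hxy hvx hvy => ?_
    obtain ⟨z, hz, hz0⟩ := hu'.exists_zero_between hx hxy hvx hvy
    refine ⟨z, hz, ?_⟩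
    by_contra hne
    exact nonlinearity_ne_zero hθ₀ (hpos z (hx.trans hz.1.le)) hne hz0
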